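/- Let $k\ge 1$ and $n=2k$. Let $\mathrm{Cl}_n$ be the real Clifford algebra of $\mathbb{R}^n$ with $v\cdot v=-\|v\|^2$, let $\mathrm{Spin}(n)\subset \mathrm{Cl}_n$ be the spin group, and let $$\mathrm{Spin}^T(n)=(\mathrm{Spin}(n)\times S^1\times S^1)/\{(1,1,1),(-1,-1,-1)\}.$$ Let $\Delta_{2k}=(\mathbb{C}^2)^{\otimes k}\cong\mathbb{C}^{2^k}$ be the spinor space, on which $\mathrm{Cl}_{2k}$ acts by the spinor representation. In the standard basis of $\mathbb{R}^{2k}$, for $1\le j\le k$, the vector $e_{2j-1}$ acts as $\sigma_3^{\otimes (j-1)}\otimes i\sigma_1\otimes 1^{\otimes(k-j)}$ and $e_{2j}$ acts as $\sigma_3^{\otimes (j-1)}\otimes i\sigma_2\otimes 1^{\otimes(k-j)}$, where $\sigma_1,\sigma_2,\sigma_3$ are the Pauli matrices. Let $\kappa$ be the restriction of this action to $\mathrm{Spin}(2k)$, and let $\kappa^T$ be the representation of $\mathrm{Spin}^T(2k)$ on $\Delta_{2k}$ given by $$\kappa^T[g,z_1,z_2]\psi=z_1^2z_2\,\kappa(g)\psi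 .$$ Let $\Delta_{2k}^{\pm}$ be the $(\pm1)$-eigenspace of the action of $i^k e_1e_2\cdots e_{2k}$ on $\Delta_{2k}$. Then $$\Delta_{2k}=\Delta_{2k}^+\oplus\Delta_{2k}^-,$$ both $\Delta_{2k}^+$ and $\Delta_{2k}^-$ are invariant under $\kappa^T$, and each of them is an irreducible representation of $\mathrm{Spin}^T(2k)$. -/

import Mathlib

noncomputable section

namespace SpinT

/-- The quadratic form `x ↦ -(x₁² + ⋯ + xₙ²)` on `ℝⁿ`. -/
abbrev negSq (n : ℕ) : QuadraticForm ℝ (Fin n → ℝ) :=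
  QuadraticMap.weightedSumSquares ℝ (fun _ : Fin n => (-1 : ℝ))

/-- The real Clifford algebra of Euclidean `ℝⁿ`, in which `v * v = -‖v‖²`. -/
abbrev Cl (n : ℕ) : Type := CliffordAlgebra (negSq n)

/-- The standard generator `eᵢ` of the Clifford algebra. -/
def e {n : ℕ} (i : Fin n) : Cl n := CliffordAlgebra.ι (negSq n) (Pi.single i 1)

/-- The group `Spin(n)` inside the Clifford algebra: even products of unit vectors. -/
abbrev Spin (n : ℕ) : Type := spinGroup (negSq n)

/-- The subgroup `{(1, 1, 1), (-1, -1, -1)}` of `Spin(n) × S¹ × S¹`. -/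
def pmOne (n : ℕ) : Subgroup (Spin n × Circle × Circle) where
  carrier := {x | x = 1 ∨ ((x.1 : Cl n) = -1 ∧ (x.2.1 : ℂ) = -1 ∧ (x.2.2 : ℂ) = -1)}
  one_mem' := Or.inl rfl
  mul_mem' := by
    rintro a b (rfl | ⟨h1, h2, h3⟩) (rfl | ⟨h4, h5, h6⟩)
    · left; simp
    · right; simpa using ⟨h4, h5, h6⟩
    · right; simpa using ⟨h1, h2, h3⟩
    · left
      refine Prod.ext (Subtype.ext ?_) (Prod.ext (Circle.ext ?_) (Circle.ext ?_)) <;>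
        simp [h1, h2, h3, h4, h5, h6]
  inv_mem' := by
    rintro a (rfl | ⟨h1, h2, h3⟩)
    · left; simp
    · right
      refine ⟨?_, ?_, ?_⟩
      · change star (a.1 : Cl n) = -1
        rw [h1]; simp
      · simp [h2]
      · simp [h3]

instance (n : ℕ) : (pmOne n).Normal where
  conj_mem := by
    rintro a (rfl | ⟨h1, h2, h3⟩) g
    · left; simp
    · right
      refine ⟨?_, ?_, ?_⟩
      · change (g.1 : Cl n) * a.1 * ((g.1⁻¹ : Spin n) : Cl n) = -1
        have h : (g.1 : Cl n) * ((g.1⁻¹ : Spin n) : Cl n) = 1 :=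
          congrArg Subtype.val (mul_inv_cancel g.1)
        rw [h1]; simp [h]
      · simp [h2]
      · simp [h3]

/-- `Spin^T(n) = (Spin(n) × S¹ × S¹) / {±1}`. -/
abbrev SpinTGroup (n : ℕ) : Type := (Spin n × Circle × Circle) ⧸ pmOne n

/-- The class `[g, z₁, z₂]`. -/
def cls {n : ℕ} (g : Spin n) (z₁ z₂ : Circle) : SpinTGroup n :=
  QuotientGroup.mk (g, z₁, z₂)

/-- The spinor space `Δ_{2k} = ℂ² ⊗ ⋯ ⊗ ℂ²` (`k` factors), i.e. `ℂ^(2^k)`, written in the product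
basis, which is indexed by `{0, 1}^k`. -/
abbrev Spinor (k : ℕ) : Type := (Fin k → Fin 2) → ℂ

/-- Square matrices acting on `Spinor k`. -/
abbrev SpinorMat (k : ℕ) : Type := Matrix (Fin k → Fin 2) (Fin k → Fin 2) ℂ

/-- The Kronecker product `m₁ ⊗ ⋯ ⊗ m_k` of `2 × 2` matrices. -/
def kron {k : ℕ} (m : Fin k → Matrix (Fin 2) (Fin 2) ℂ) : SpinorMat k :=
  Matrix.of fun a b => ∏ j, m j (a j) (b j)

theorem kron_mul {k : ℕ} (m m' : Fin k → Matrix (Fin 2) (Fin 2) ℂ) :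
    kron m * kron m' = kron (fun j => m j * m' j) := by
  ext a b
  simp only [kron, Matrix.mul_apply, Matrix.of_apply, ← Finset.prod_mul_distrib]
  rw [Finset.prod_univ_sum]
  simp

theorem kron_one {k : ℕ} : kron (fun _ : Fin k => (1 : Matrix (Fin 2) (Fin 2) ℂ)) = 1 := by
  ext a b
  simp only [kron, Matrix.of_apply, Matrix.one_apply]
  by_cases h : a = b
  · simp [h]
  · obtain ⟨j, hj⟩ := Function.ne_iff.mp h
    rw [if_neg h]
    exact Finset.prod_eq_zero (Finset.mem_univ j) (by simp [hj])

theorem kron_neg {k : ℕ} (m m' : Fin k → Matrix (Fin 2) (Fin 2) ℂ) (j₀ : Fin k)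
    (h₀ : m j₀ = -m' j₀) (h : ∀ j, j ≠ j₀ → m j = m' j) : kron m = -kron m' := by
  ext a b
  simp only [kron, Matrix.of_apply, Matrix.neg_apply]
  rw [← Finset.mul_prod_erase _ _ (Finset.mem_univ j₀),
    ← Finset.mul_prod_erase _ (fun j => m' j (a j) (b j)) (Finset.mem_univ j₀), h₀]
  rw [Finset.prod_congr rfl fun j hj => by rw [h j (Finset.ne_of_mem_erase hj)]]
  simp

def pauli1 : Matrix (Fin 2) (Fin 2) ℂ := !![0, 1; 1, 0]

def pauli2 : Matrix (Fin 2) (Fin 2) ℂ := !![0, -Complex.I; Complex.I, 0]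

def pauli3 : Matrix (Fin 2) (Fin 2) ℂ := !![1, 0; 0, -1]

/-- The `j`-th tensor factor of the matrix by which the `i`-th unit vector acts on spinors. -/
def gammaFactor {k : ℕ} (i : Fin (2 * k)) (j : Fin k) : Matrix (Fin 2) (Fin 2) ℂ :=
  if (j : ℕ) < (i : ℕ) / 2 then pauli3
  else if (j : ℕ) = (i : ℕ) / 2 then
    (if (i : ℕ) % 2 = 0 then Complex.I • pauli1 else Complex.I • pauli2)
  else 1

/-- With indices starting at `0`, the unit vector `e_{2j}` acts by
`σ₃ ⊗ ⋯ ⊗ σ₃ ⊗ iσ₁ ⊗ 1 ⊗ ⋯ ⊗ 1` and `e_{2j+1}` by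
`σ₃ ⊗ ⋯ ⊗ σ₃ ⊗ iσ₂ ⊗ 1 ⊗ ⋯ ⊗ 1`, with `j` factors `σ₃` in front. -/
def gamma {k : ℕ} (i : Fin (2 * k)) : SpinorMat k := kron (gammaFactor i)

theorem gamma_sq {k : ℕ} (i : Fin (2 * k)) : gamma i * gamma i = -1 := by
  rw [gamma, kron_mul, ← kron_one]
  refine kron_neg _ _ ⟨(i : ℕ) / 2, by omega⟩ ?_ ?_
  · simp only [gammaFactor, lt_irrefl, if_false, if_true]
    split_ifs <;> ext a b <;> fin_cases a <;> fin_cases b <;> simp [pauli1, pauli2]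
  · intro j hj
    have hj' : (j : ℕ) ≠ (i : ℕ) / 2 := fun h => hj (Fin.ext h)
    simp only [gammaFactor, hj', if_false]
    split_ifs
    · ext a b; fin_cases a <;> fin_cases b <;> simp [pauli3]
    · simp

theorem gamma_anticomm_of_lt {k : ℕ} {i j : Fin (2 * k)} (h : i < j) :
    gamma i * gamma j = -(gamma j * gamma i) := by
  have h' : (i : ℕ) < j := h
  rw [gamma, gamma, kron_mul, kron_mul]
  refine kron_neg _ _ ⟨(i : ℕ) / 2, by omega⟩ ?_ ?_
  · rcases Nat.lt_or_ge ((i : ℕ) / 2) ((j : ℕ) / 2) with hlt | hge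
    · simp only [gammaFactor, lt_irrefl, if_false, if_true, hlt]
      split_ifs <;> ext a b <;> fin_cases a <;> fin_cases b <;>
        simp [pauli1, pauli2, pauli3]
    · have h1 : (i : ℕ) / 2 = (j : ℕ) / 2 := by omega
      have h2 : (i : ℕ) % 2 = 0 := by omega
      have h3 : (j : ℕ) % 2 ≠ 0 := by omega
      simp only [gammaFactor, h1, h2, h3, lt_irrefl, if_false, if_true]
      ext a b
      fin_cases a <;> fin_cases b <;> simp [pauli1, pauli2]
  · intro l hl
    have hl' : (l : ℕ) ≠ (i : ℕ) / 2 := fun h => hl (Fin.ext h)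
    simp only [gammaFactor, hl', if_false]
    rcases Nat.lt_or_ge (l : ℕ) ((i : ℕ) / 2) with hlt | hge
    · have : (l : ℕ) < (j : ℕ) / 2 := by omega
      simp [hlt, this]
    · simp [not_lt.mpr hge]

theorem gamma_anticomm {k : ℕ} {i j : Fin (2 * k)} (h : i ≠ j) :
    gamma i * gamma j = -(gamma j * gamma i) := by
  rcases lt_or_gt_of_ne h with h | h
  · exact gamma_anticomm_of_lt h
  · rw [gamma_anticomm_of_lt h, neg_neg]

/-- Clifford multiplication by vectors, `x ↦ ∑ xᵢ γᵢ`. -/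
def vecMul (k : ℕ) : (Fin (2 * k) → ℝ) →ₗ[ℝ] SpinorMat k :=
  Fintype.linearCombination ℝ (gamma (k := k))

theorem vecMul_sq (k : ℕ) (x : Fin (2 * k) → ℝ) :
    vecMul k x * vecMul k x = algebraMap ℝ (SpinorMat k) (negSq (2 * k) x) := by
  have key : ∀ i j : Fin (2 * k), gamma i * gamma j + gamma j * gamma i =
      if i = j then (-2 : ℝ) • (1 : SpinorMat k) else 0 := by
    intro i j
    split_ifs with h
    · subst h
      rw [gamma_sq]; module
    · rw [gamma_anticomm h]; simp
  have h1 : vecMul k x * vecMul k x = ∑ i, ∑ j, (x i * x j) • (gamma i * gamma j) := by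
    simp only [vecMul, Fintype.linearCombination_apply, Finset.sum_mul_sum, smul_mul_smul_comm]
  have h2 : vecMul k x * vecMul k x = ∑ i, ∑ j, (x i * x j) • (gamma j * gamma i) := by
    rw [h1, Finset.sum_comm]
    refine Finset.sum_congr rfl fun i _ => Finset.sum_congr rfl fun j _ => ?_
    rw [mul_comm (x j)]
  have h3 : (2 : ℝ) • (vecMul k x * vecMul k x) =
      (2 : ℝ) • algebraMap ℝ (SpinorMat k) (negSq (2 * k) x) := by
    rw [two_smul]
    nth_rewrite 1 [h1]
    rw [h2, ← Finset.sum_add_distrib]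
    simp only [← Finset.sum_add_distrib, ← smul_add, key]
    simp only [smul_ite, smul_zero, Finset.sum_ite_eq, Finset.mem_univ, if_true, smul_smul,
      ← Finset.sum_smul, Algebra.algebraMap_eq_smul_one,
      QuadraticMap.weightedSumSquares_apply]
    congr 1
    rw [Finset.mul_sum]
    refine Finset.sum_congr rfl fun i _ => ?_
    simp only [smul_eq_mul]
    ring
  exact smul_right_injective _ (two_ne_zero : (2 : ℝ) ≠ 0) h3

/-- The spinor representation of the Clifford algebra on `Δ_{2k}`: the algebra homomorphism
determined by `eᵢ ↦ γᵢ`. -/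
def cliffordRep (k : ℕ) : Cl (2 * k) →ₐ[ℝ] Module.End ℂ (Spinor k) :=
  ((Matrix.toLinAlgEquiv' (R := ℂ) (n := Fin k → Fin 2)).toAlgHom.restrictScalars ℝ).comp
    (CliffordAlgebra.lift (negSq (2 * k)) ⟨vecMul k, vecMul_sq k⟩)

theorem cliffordRep_e (k : ℕ) (i : Fin (2 * k)) (ψ : Spinor k) :
    cliffordRep k (e i) ψ = (gamma i).mulVec ψ := by
  simp [cliffordRep, e, vecMul]

/-- The spin representation `κ` of `Spin(2k)`: the restriction of the Clifford representation. -/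
def kappa (k : ℕ) : Representation ℂ (Spin (2 * k)) (Spinor k) :=
  (cliffordRep k : Cl (2 * k) →* Module.End ℂ (Spinor k)).comp (spinGroup (negSq (2 * k))).subtype

/-- The representation `(g, z₁, z₂) ↦ z₁² z₂ κ(g)` of `Spin(2k) × S¹ × S¹`. -/
def kappaProd (k : ℕ) : Representation ℂ (Spin (2 * k) × Circle × Circle) (Spinor k) where
  toFun x := ((x.2.1 : ℂ) ^ 2 * (x.2.2 : ℂ)) • kappa k x.1
  map_one' := by simp
  map_mul' x y := by
    simp only [Prod.fst_mul, Prod.snd_mul, Circle.coe_mul, map_mul, smul_mul_smul_comm]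
    congr 1
    ring

/-- The spinor representation `κ^T` of `Spin^T(2k)`. -/
def kappaT (k : ℕ) : Representation ℂ (SpinTGroup (2 * k)) (Spinor k) :=
  QuotientGroup.lift (pmOne (2 * k)) (kappaProd k) (by
    rintro x (rfl | ⟨h1, h2, h3⟩)
    · exact map_one _
    · change ((x.2.1 : ℂ) ^ 2 * (x.2.2 : ℂ)) • cliffordRep k (x.1 : Cl (2 * k)) = 1
      rw [h1, h2, h3]
      simp)

theorem kappaT_cls (k : ℕ) (g : Spin (2 * k)) (z₁ z₂ : Circle) (ψ : Spinor k) :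
    kappaT k (cls g z₁ z₂) ψ = ((z₁ : ℂ) ^ 2 * (z₂ : ℂ)) • kappa k g ψ :=
  rfl

/-- The complex volume element `i^k e₁ e₂ ⋯ e_{2k}`, acting on spinors. -/
def volume (k : ℕ) : Module.End ℂ (Spinor k) :=
  Complex.I ^ k • cliffordRep k (List.ofFn (fun i : Fin (2 * k) => e i)).prod

/-- The positive half-spinors `Δ⁺_{2k}`. -/
def spinorPlus (k : ℕ) : Submodule ℂ (Spinor k) := (volume k).eigenspace 1

/-- The negative half-spinors `Δ⁻_{2k}`. -/
def spinorMinus (k : ℕ) : Submodule ℂ (Spinor k) := (volume k).eigenspace (-1)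

end SpinT

end

namespace SpinT

open Matrix

/-! In the product basis each pair `e (evenIdx j) * e (oddIdx j)` acts diagonally, as `-i σ₃` in
slot `j`. Hence the volume element is diagonal with entries `parity a = ±1` (`volume_eq`); it is an
involution, and its eigenspaces split the spinors. Vectors anticommute with it, so the even group
Spin commutes with it and preserves both eigenspaces (`volume_kappa`).

For irreducibility only the products `e i * e j` in Spin are needed. Let `W ≠ 0` be stable under
them. The diagonal pairs separate the basis spinors, so `W` contains one of them
(`exists_single_mem`). Products of two even-indexed vectors flip two slots up to a nonzero scalar
(`single_flip_flip_mem`), so `W` contains every basis spinor of the same parity, and these span the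
eigenspace. -/

theorem e_mul_self {n : ℕ} (i : Fin n) : (e i : Cl n) * e i = -1 := by
  rw [e, CliffordAlgebra.ι_sq_scalar]
  simp [QuadraticMap.weightedSumSquares_apply, Pi.single_apply]

theorem star_e {n : ℕ} (i : Fin n) : star (e i : Cl n) = -e i := by
  simp [e, CliffordAlgebra.star_ι]

theorem e_mem_pinGroup {n : ℕ} (i : Fin n) : (e i : Cl n) ∈ pinGroup (negSq n) := by
  refine pinGroup.mem_iff.mpr ⟨⟨⟨e i, -e i, ?_, ?_⟩, ?_, rfl⟩, ?_⟩
  · rw [mul_neg, e_mul_self, neg_neg]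
  · rw [neg_mul, e_mul_self, neg_neg]
  · exact Subgroup.subset_closure ⟨Pi.single i 1, rfl⟩
  · refine Unitary.mem_iff.mpr ⟨?_, ?_⟩
    · rw [star_e, neg_mul, e_mul_self, neg_neg]
    · rw [star_e, mul_neg, e_mul_self, neg_neg]

theorem e_mul_e_mem_spinGroup {n : ℕ} (i j : Fin n) :
    (e i * e j : Cl n) ∈ spinGroup (negSq n) :=
  spinGroup.mem_iff.mpr ⟨mul_mem (e_mem_pinGroup i) (e_mem_pinGroup j),
    CliffordAlgebra.ι_mul_ι_mem_evenOdd_zero _ _ _⟩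

/-! ### The volume element in the product basis -/

/-- The diagonal entries of `σ₃`. -/
def sgn (x : Fin 2) : ℂ := if x = 0 then 1 else -1

theorem sgn_mul_self (x : Fin 2) : sgn x * sgn x = 1 := by
  fin_cases x <;> simp [sgn]

theorem sgn_injective : Function.Injective sgn := by
  intro x y
  fin_cases x <;> fin_cases y <;> simp [sgn] <;> norm_num

/-- The eigenvalue of the complex volume element on a basis spinor. -/
def parity {k : ℕ} (a : Fin k → Fin 2) : ℂ := ∏ j, sgn (a j)

theorem parity_mul_self {k : ℕ} (a : Fin k → Fin 2) : parity a * parity a = 1 := by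
  simp [parity, ← Finset.prod_mul_distrib, sgn_mul_self]

theorem kron_diagonal {k : ℕ} (d : Fin k → Fin 2 → ℂ) :
    kron (fun j => diagonal (d j)) = diagonal (fun a => ∏ j, d j (a j)) := by
  ext a b
  simp only [kron, of_apply, diagonal_apply]
  by_cases h : a = b
  · simp [h]
  · obtain ⟨j, hj⟩ := Function.ne_iff.mp h
    rw [if_neg h]
    exact Finset.prod_eq_zero (Finset.mem_univ j) (by simp [hj])

/-- The index `2j` of the first vector of the `j`-th pair. -/
def evenIdx {k : ℕ} (j : Fin k) : Fin (2 * k) := ⟨2 * j, by omega⟩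

/-- The index `2j + 1` of the second vector of the `j`-th pair. -/
def oddIdx {k : ℕ} (j : Fin k) : Fin (2 * k) := ⟨2 * j + 1, by omega⟩

/-- Slotwise: the leading factors `σ₃` square to 1, and `(iσ₁)(iσ₂) = -iσ₃` in slot `j`. -/
theorem gamma_even_mul_gamma_odd {k : ℕ} (j : Fin k) :
    gamma (evenIdx j) * gamma (oddIdx j) = diagonal (fun a => -Complex.I * sgn (a j)) := by
  have hdiag : ∀ l : Fin k, gammaFactor (evenIdx j) l * gammaFactor (oddIdx j) l =
      diagonal (fun x => if l = j then -Complex.I * sgn x else 1) := by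
    intro l
    have h2 : (2 * (j : ℕ) + 1) / 2 = j := by omega
    have h3 : (2 * (j : ℕ) + 1) % 2 = 1 := by omega
    rcases lt_trichotomy (l : ℕ) j with h | h | h
    · have hne : l ≠ j := fun h' => h.ne (congrArg Fin.val h')
      ext a b
      fin_cases a <;> fin_cases b <;> simp [gammaFactor, evenIdx, oddIdx, h2, h, hne, pauli3]
    · have heq : l = j := Fin.ext h
      subst heq
      ext a b
      fin_cases a <;> fin_cases b <;>
        simp [gammaFactor, evenIdx, oddIdx, h2, h3, pauli1, pauli2, sgn]
    · have hne : l ≠ j := fun h' => h.ne' (congrArg Fin.val h')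
      ext a b
      fin_cases a <;> fin_cases b <;>
        simp [gammaFactor, evenIdx, oddIdx, h2, h.not_gt, Fin.val_ne_of_ne hne, hne]
  rw [gamma, gamma, kron_mul, funext hdiag, kron_diagonal]
  congr 1
  funext a
  simp

theorem cliffordRep_eq_toLin' (k : ℕ) (i : Fin (2 * k)) :
    cliffordRep k (e i) = toLin' (gamma i) :=
  LinearMap.ext fun ψ => by rw [cliffordRep_e, toLin'_apply]

theorem cliffordRep_even_mul_odd {k : ℕ} (j : Fin k) :
    cliffordRep k (e (evenIdx j) * e (oddIdx j)) =
      toLin' (diagonal (fun a => -Complex.I * sgn (a j))) := by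
  rw [map_mul, cliffordRep_eq_toLin', cliffordRep_eq_toLin', ← gamma_even_mul_gamma_odd,
    toLin'_mul]
  rfl

theorem list_prod_e (k : ℕ) : (List.ofFn (fun i : Fin (2 * k) => (e i : Cl (2 * k)))).prod =
    (List.ofFn (fun j : Fin k => (e (evenIdx j) * e (oddIdx j) : Cl (2 * k)))).prod := by
  rw [List.ofFn_mul', List.prod_flatten, List.map_ofFn]
  congr 2
  funext j
  simp [evenIdx, oddIdx, List.ofFn_succ]

theorem volume_eq (k : ℕ) : volume k = toLin' (diagonal parity) := by
  have h : cliffordRep k (List.ofFn (fun i : Fin (2 * k) => e i)).prod =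
      toLin' (diagonal (fun a => ∏ j, (-Complex.I * sgn (a j)))) := by
    rw [list_prod_e, map_list_prod, List.map_ofFn]
    -- All pairs lie in the image of the commutative ring of diagonals, where the ordered product
    -- becomes pointwise.
    have h1 : (cliffordRep k ∘ fun j : Fin k => (e (evenIdx j) * e (oddIdx j) : Cl (2 * k))) =
        ((toLinAlgEquiv' (R := ℂ) (n := Fin k → Fin 2)).toRingEquiv.toRingHom.comp
          (diagonalRingHom (Fin k → Fin 2) ℂ)) ∘ fun j a => -Complex.I * sgn (a j) :=
      funext fun j => cliffordRep_even_mul_odd j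
    rw [h1, ← List.map_ofFn, ← map_list_prod, List.prod_ofFn]
    have h2 : (∏ j : Fin k, fun a : Fin k → Fin 2 => -Complex.I * sgn (a j)) =
        fun a => ∏ j, (-Complex.I * sgn (a j)) := by
      funext a; simp
    rw [h2]
    rfl
  rw [volume, h, ← map_smul]
  congr 1
  rw [← diagonal_smul]
  congr 1
  funext a
  simp only [Pi.smul_apply, parity, smul_eq_mul, Finset.prod_mul_distrib, Finset.prod_const,
    Finset.card_univ, Fintype.card_fin]
  -- The prefactor `i^k` cancels `(-i)^k`.
  rw [← mul_assoc, ← mul_pow]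
  simp

theorem volume_apply {k : ℕ} (ψ : Spinor k) (a : Fin k → Fin 2) :
    volume k ψ a = parity a * ψ a := by
  rw [volume_eq, toLin'_apply, mulVec_diagonal]

theorem mem_eigenspace_volume {k : ℕ} {ε : ℂ} {ψ : Spinor k} :
    ψ ∈ (volume k).eigenspace ε ↔ ∀ a, parity a * ψ a = ε * ψ a := by
  rw [Module.End.mem_eigenspace_iff, funext_iff]
  simp [volume_apply]

theorem single_mem_eigenspace_volume {k : ℕ} {ε : ℂ} {a : Fin k → Fin 2} :
    (Pi.single a 1 : Spinor k) ∈ (volume k).eigenspace ε ↔ parity a = ε := by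
  rw [mem_eigenspace_volume]
  refine ⟨fun h => by simpa using h a, fun h b => ?_⟩
  by_cases hb : b = a
  · subst hb; simp [h]
  · simp [hb]

theorem volume_mul_self (k : ℕ) : volume k * volume k = 1 := by
  refine LinearMap.ext fun ψ => funext fun a => ?_
  rw [Module.End.mul_apply, volume_apply, volume_apply, ← mul_assoc, parity_mul_self, one_mul]
  rfl

theorem isCompl_spinorPlus_spinorMinus (k : ℕ) : IsCompl (spinorPlus k) (spinorMinus k) := by
  have hv : ∀ ψ, volume k (volume k ψ) = ψ := fun ψ => LinearMap.congr_fun (volume_mul_self k) ψ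
  refine IsCompl.of_eq ?_ ?_
  · rw [eq_bot_iff]
    rintro ψ ⟨h1, h2⟩
    have h1 : volume k ψ = (1 : ℂ) • ψ := Module.End.mem_eigenspace_iff.mp h1
    have h2 : volume k ψ = (-1 : ℂ) • ψ := Module.End.mem_eigenspace_iff.mp h2
    rw [h1, one_smul, neg_one_smul] at h2
    exact self_eq_neg.mp h2
  · rw [eq_top_iff]
    intro ψ _
    refine Submodule.mem_sup.mpr ⟨(1 / 2 : ℂ) • (ψ + volume k ψ), ?_,
      (1 / 2 : ℂ) • (ψ - volume k ψ), ?_, ?_⟩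
    · rw [spinorPlus, Module.End.mem_eigenspace_iff, map_smul, map_add, hv]
      module
    · rw [spinorMinus, Module.End.mem_eigenspace_iff, map_smul, map_sub, hv]
      module
    · module

/-! ### Commutation of the volume element with Spin -/

theorem diagonal_parity_mul_gamma {k : ℕ} (i : Fin (2 * k)) :
    diagonal parity * gamma i = -(gamma i * diagonal parity) := by
  have hs : diagonal sgn = pauli3 := by
    ext a b; fin_cases a <;> fin_cases b <;> simp [pauli3, sgn]
  have h : (diagonal parity : SpinorMat k) = kron (fun _ => pauli3) := by
    rw [← hs]
    exact (kron_diagonal fun _ => sgn).symm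
  rw [h, gamma, kron_mul, kron_mul]
  -- `σ₃` anticommutes with `iσ₁` and `iσ₂` and commutes with `σ₃` and 1, so exactly one slot
  -- contributes a sign.
  refine kron_neg _ _ ⟨(i : ℕ) / 2, by omega⟩ ?_ ?_
  · simp only [gammaFactor, lt_irrefl, if_false, if_true]
    split_ifs <;> ext a b <;> fin_cases a <;> fin_cases b <;> simp [pauli1, pauli2, pauli3]
  · intro j hj
    have hj' : (j : ℕ) ≠ (i : ℕ) / 2 := fun h => hj (Fin.ext h)
    simp only [gammaFactor, hj', if_false]
    split_ifs
    · rfl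
    · simp

theorem cliffordRep_ι (k : ℕ) (v : Fin (2 * k) → ℝ) :
    cliffordRep k (CliffordAlgebra.ι (negSq (2 * k)) v) = toLin' (vecMul k v) := by
  refine LinearMap.ext fun ψ => ?_
  simp [cliffordRep]

/-- The twist by `involute` makes the relation multiplicative, so it need only be checked on
vectors; it disappears on even elements. -/
theorem volume_mul_cliffordRep {k : ℕ} (x : Cl (2 * k)) :
    volume k * cliffordRep k x = cliffordRep k (CliffordAlgebra.involute x) * volume k := by
  induction x using CliffordAlgebra.induction with
  | algebraMap r =>
    rw [AlgHom.commutes, AlgHom.commutes, AlgHom.commutes]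
    exact (Algebra.commutes r (volume k)).symm
  | ι v =>
    have h : diagonal parity * vecMul k v = -(vecMul k v * diagonal parity) := by
      simp only [vecMul, Fintype.linearCombination_apply, Finset.mul_sum, Finset.sum_mul,
        mul_smul_comm, smul_mul_assoc, diagonal_parity_mul_gamma, smul_neg, Finset.sum_neg_distrib]
    rw [CliffordAlgebra.involute_ι, map_neg, cliffordRep_ι, volume_eq]
    refine LinearMap.ext fun ψ => ?_
    simp only [Module.End.mul_apply, LinearMap.neg_apply, toLin'_apply, mulVec_mulVec, h,
      neg_mulVec]
  | mul x y hx hy =>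
    rw [map_mul, map_mul, map_mul, ← mul_assoc, hx, mul_assoc, hy, mul_assoc]
  | add x y hx hy =>
    rw [map_add, map_add, map_add, mul_add, add_mul, hx, hy]

theorem volume_kappa {k : ℕ} (g : Spin (2 * k)) (ψ : Spinor k) :
    volume k (kappa k g ψ) = kappa k g (volume k ψ) := by
  have h := volume_mul_cliffordRep (g : Cl (2 * k))
  rw [spinGroup.involute_eq g.2] at h
  exact LinearMap.congr_fun h ψ

/-- An eigenspace of the complex volume element, as a subrepresentation of `κ^T`. -/
noncomputable def volumeEigenspace (k : ℕ) (ε : ℂ) : Subrepresentation (kappaT k) where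
  toSubmodule := (volume k).eigenspace ε
  apply_mem_toSubmodule x ψ hψ := by
    obtain ⟨⟨g, z₁, z₂⟩, rfl⟩ := QuotientGroup.mk_surjective x
    change kappaT k (cls g z₁ z₂) ψ ∈ _
    rw [kappaT_cls]
    refine Submodule.smul_mem _ _ ?_
    rw [Module.End.mem_eigenspace_iff] at hψ ⊢
    rw [volume_kappa, hψ, map_smul]

/-! ### Subspaces stable under products of two basis vectors -/

/-- Exchange of `0` and `1` in position `j`. -/
def flip {k : ℕ} (j : Fin k) (a : Fin k → Fin 2) : Fin k → Fin 2 :=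
  Function.update a j (1 - a j)

theorem flip_apply_of_ne {k : ℕ} {j l : Fin k} (h : l ≠ j) (a : Fin k → Fin 2) :
    flip j a l = a l := by
  simp [flip, h]

theorem exists_gamma_even_mulVec_single {k : ℕ} (j : Fin k) (c : Fin k → Fin 2) :
    ∃ r : ℂ, r ≠ 0 ∧ (gamma (evenIdx j)).mulVec (Pi.single c 1) =
      r • (Pi.single (flip j c) 1 : Spinor k) := by
  have hlt : ∀ l : Fin k, (l : ℕ) < j → gammaFactor (evenIdx j) l = pauli3 := by
    intro l h
    simp [gammaFactor, evenIdx, h]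
  have heq : gammaFactor (evenIdx j) j = Complex.I • pauli1 := by
    simp [gammaFactor, evenIdx]
  have hgt : ∀ l : Fin k, (j : ℕ) < l → gammaFactor (evenIdx j) l = 1 := by
    intro l h
    simp [gammaFactor, evenIdx, h.not_gt, h.ne']
  -- Each tensor factor has exactly one nonzero entry per column, hence so does `gamma`.
  have hcol : ∀ l x, gammaFactor (evenIdx j) l x (c l) ≠ 0 ↔ x = flip j c l := by
    intro l x
    rcases lt_trichotomy (l : ℕ) j with h | h | h
    · rw [flip_apply_of_ne (Fin.ne_of_lt h), hlt l h]
      generalize c l = y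
      fin_cases x <;> fin_cases y <;> simp [pauli3]
    · have h : l = j := Fin.ext h
      subst h
      rw [flip, Function.update_self, heq]
      generalize c l = y
      fin_cases x <;> fin_cases y <;> simp [pauli1]
    · rw [flip_apply_of_ne (Fin.ne_of_gt h), hgt l h]
      generalize c l = y
      fin_cases x <;> fin_cases y <;> simp
  refine ⟨∏ l, gammaFactor (evenIdx j) l (flip j c l) (c l),
    Finset.prod_ne_zero_iff.mpr fun l _ => (hcol l _).mpr rfl, funext fun a => ?_⟩
  rw [mulVec_single_one]
  by_cases ha : a = flip j c
  · subst ha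
    simp [gamma, kron]
  · obtain ⟨l, hl⟩ := Function.ne_iff.mp ha
    rw [Pi.smul_apply, Pi.single_eq_of_ne ha, smul_zero]
    exact Finset.prod_eq_zero (Finset.mem_univ l) (not_not.mp fun h => hl ((hcol l _).mp h))

section Invariant

variable {k : ℕ} {W : Submodule ℂ (Spinor k)}
  (hW : ∀ i j : Fin (2 * k), ∀ ψ ∈ W, cliffordRep k (e i * e j) ψ ∈ W)

include hW

theorem single_flip_flip_mem {c : Fin k → Fin 2} (hc : (Pi.single c 1 : Spinor k) ∈ W)
    (i j : Fin k) : (Pi.single (flip i (flip j c)) 1 : Spinor k) ∈ W := by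
  obtain ⟨r, hr, h1⟩ := exists_gamma_even_mulVec_single j c
  obtain ⟨s, hs, h2⟩ := exists_gamma_even_mulVec_single i (flip j c)
  have h := hW (evenIdx i) (evenIdx j) _ hc
  rw [map_mul, Module.End.mul_apply, cliffordRep_e, cliffordRep_e, h1, mulVec_smul, h2,
    smul_smul] at h
  exact (Submodule.smul_mem_iff _ (mul_ne_zero hr hs)).mp h

theorem restrict_mem {ψ : Spinor k} (hψ : ψ ∈ W) (a : Fin k → Fin 2) (s : Finset (Fin k)) :
    (fun c => if ∀ j ∈ s, c j = a j then ψ c else 0) ∈ W := by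
  induction s using Finset.induction_on with
  | empty => simpa using hψ
  | insert j s _ ih =>
    -- The operator `(1 + i sgn(a j) e (evenIdx j) e (oddIdx j)) / 2` is the projection onto `c j =
    -- a j`.
    have h := W.smul_mem (1 / 2 : ℂ) (W.add_mem ih
      (W.smul_mem (Complex.I * sgn (a j)) (hW (evenIdx j) (oddIdx j) _ ih)))
    convert! h using 1
    funext c
    rw [cliffordRep_even_mul_odd, toLin'_apply]
    simp only [Pi.smul_apply, Pi.add_apply, mulVec_diagonal, smul_eq_mul,
      Finset.forall_mem_insert]
    by_cases hs : ∀ l ∈ s, c l = a l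
    · have hI : Complex.I * sgn (a j) * (-Complex.I * sgn (c j) * ψ c) =
          sgn (a j) * sgn (c j) * ψ c := by
        linear_combination (-(sgn (a j) * sgn (c j) * ψ c)) * Complex.I_mul_I
      rw [if_congr (and_iff_left hs) rfl rfl, if_pos hs, hI]
      generalize c j = x
      generalize a j = y
      fin_cases x <;> fin_cases y <;> simp [sgn] <;> ring
    · simp [hs]

theorem exists_single_mem (hne : W ≠ ⊥) : ∃ a, (Pi.single a 1 : Spinor k) ∈ W := by
  obtain ⟨ψ, hψ, h0⟩ := W.exists_mem_ne_zero_of_ne_bot hne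
  obtain ⟨a, ha⟩ := Function.ne_iff.mp h0
  refine ⟨a, (Submodule.smul_mem_iff W ha).mp ?_⟩
  convert! restrict_mem hW hψ a Finset.univ using 1
  funext c
  by_cases hc : c = a
  · subst hc; simp
  · have : ¬ ∀ j, c j = a j := fun h => hc (funext h)
    simp [hc, this]

/-- Flips come in pairs; slot `i` absorbs the second flip of each pair, so the others can be
corrected one at a time. -/
theorem exists_single_mem_eqOn {a : Fin k → Fin 2} (ha : (Pi.single a 1 : Spinor k) ∈ W)
    (b : Fin k → Fin 2) (i : Fin k) (s : Finset (Fin k)) :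
    ∃ c, (Pi.single c 1 : Spinor k) ∈ W ∧ ∀ j ∈ s, j ≠ i → c j = b j := by
  induction s using Finset.induction_on with
  | empty => exact ⟨a, ha, by simp⟩
  | insert l s _ ih =>
    obtain ⟨c, hc, h⟩ := ih
    by_cases hl : c l = b l
    · refine ⟨c, hc, fun j hj hji => ?_⟩
      rcases Finset.mem_insert.mp hj with rfl | hj
      · exact hl
      · exact h j hj hji
    · refine ⟨_, single_flip_flip_mem hW hc i l, fun j hj hji => ?_⟩
      rw [flip_apply_of_ne hji]
      by_cases hjl : j = l
      · subst hjl
        rw [flip, Function.update_self]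
        omega
      · rw [flip_apply_of_ne hjl]
        exact h j (Finset.mem_of_mem_insert_of_ne hj hjl) hji

theorem eigenspace_le_of_invariant (i : Fin k) {ε : ℂ} (hle : W ≤ (volume k).eigenspace ε)
    (hne : W ≠ ⊥) : (volume k).eigenspace ε ≤ W := by
  obtain ⟨a, ha⟩ := exists_single_mem hW hne
  have hbasis : ∀ b, parity b = ε → (Pi.single b 1 : Spinor k) ∈ W := by
    intro b hb
    obtain ⟨c, hc, h⟩ := exists_single_mem_eqOn hW ha b i Finset.univ
    have hcb : parity c = parity b :=
      (single_mem_eigenspace_volume.mp (hle hc)).trans hb.symm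
    have hE : ∀ j ∈ Finset.univ.erase i, sgn (c j) = sgn (b j) := fun j hj => by
      rw [h j (Finset.mem_univ j) (Finset.ne_of_mem_erase hj)]
    -- Equal parities and agreement elsewhere force agreement in the spare slot.
    have hi : c i = b i := by
      rw [parity, parity, ← Finset.mul_prod_erase _ _ (Finset.mem_univ i),
        ← Finset.mul_prod_erase _ (fun j => sgn (b j)) (Finset.mem_univ i),
        Finset.prod_congr rfl hE] at hcb
      refine sgn_injective (mul_right_cancel₀ (Finset.prod_ne_zero_iff.mpr fun j _ h0 => ?_) hcb)
      simpa [h0] using sgn_mul_self (b j)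
    have : c = b := funext fun j => by
      by_cases hj : j = i
      · rw [hj, hi]
      · exact h j (Finset.mem_univ j) hj
    rwa [← this]
  intro ψ hψ
  rw [pi_eq_sum_univ' ψ]
  refine W.sum_mem fun b _ => ?_
  by_cases h0 : ψ b = 0
  · simp [h0]
  · have hb := mul_right_cancel₀ h0 (mem_eigenspace_volume.mp hψ b)
    refine W.smul_mem _ ?_
    convert! hbasis b hb using 1

end Invariant

theorem volumeEigenspace_isIrreducible {k : ℕ} (i : Fin k) {a : Fin k → Fin 2} {ε : ℂ}
    (ha : parity a = ε) : (volumeEigenspace k ε).toRepresentation.IsIrreducible := by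
  have hmem : (Pi.single a 1 : Spinor k) ∈ (volume k).eigenspace ε :=
    single_mem_eigenspace_volume.mpr ha
  refine { exists_pair_ne := ⟨⊥, ⊤, fun h => ?_⟩, eq_bot_or_eq_top := fun σ => ?_ }
  · have h : (⊥ : Submodule ℂ (volumeEigenspace k ε).toSubmodule) = ⊤ :=
      congrArg Subrepresentation.toSubmodule h
    have h1 : (⟨Pi.single a 1, hmem⟩ : (volumeEigenspace k ε).toSubmodule) ∈
        (⊥ : Submodule ℂ (volumeEigenspace k ε).toSubmodule) := h ▸ Submodule.mem_top
    have h2 := congrFun (congrArg Subtype.val ((Submodule.mem_bot ℂ).mp h1)) a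
    simp at h2
  · refine or_iff_not_imp_left.mpr fun hσ => Subrepresentation.toSubmodule_injective ?_
    have hbot : σ.toSubmodule ≠ ⊥ := fun h => hσ (Subrepresentation.toSubmodule_injective h)
    -- Stability of the image of `σ` in the full spinor space comes from the classes `[e i * e j, 1,
    -- 1]`.
    have hW : ∀ i j : Fin (2 * k),
        ∀ ψ ∈ σ.toSubmodule.map (volumeEigenspace k ε).toSubmodule.subtype,
        cliffordRep k (e i * e j) ψ ∈
          σ.toSubmodule.map (volumeEigenspace k ε).toSubmodule.subtype := by
      rintro i j _ ⟨ψ, hψ, rfl⟩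
      refine ⟨_, σ.apply_mem_toSubmodule (cls ⟨e i * e j, e_mul_e_mem_spinGroup i j⟩ 1 1) hψ, ?_⟩
      change kappaT k (cls _ 1 1) (ψ : Spinor k) = _
      rw [kappaT_cls]
      simp [kappa]
    have hle := eigenspace_le_of_invariant hW i (ε := ε)
      (Submodule.map_subtype_le (volumeEigenspace k ε).toSubmodule _)
      (fun h => hbot ((Submodule.map_injective_of_injective (Submodule.subtype_injective _))
        (h.trans (Submodule.map_bot _).symm)))
    change σ.toSubmodule = ⊤
    rw [eq_top_iff]
    rintro ⟨ψ, hψ⟩ _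
    obtain ⟨φ, hφ, h⟩ := hle hψ
    have h : φ = ⟨ψ, hψ⟩ := Subtype.ext h
    exact h ▸ hφ

end SpinT

theorem mainTheorem5 (k : ℕ) (hk : 1 ≤ k) :
    IsCompl (SpinT.spinorPlus k) (SpinT.spinorMinus k) ∧
    ∃ Sp Sm : Subrepresentation (SpinT.kappaT k),
      Sp.toSubmodule = SpinT.spinorPlus k ∧
      Sm.toSubmodule = SpinT.spinorMinus k ∧
      Sp.toRepresentation.IsIrreducible ∧
      Sm.toRepresentation.IsIrreducible := by
  -- The all-zero index has parity 1; a single 1, in slot 0, gives parity -1. Both eigenspaces are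
  -- thus nonzero.
  refine ⟨SpinT.isCompl_spinorPlus_spinorMinus k, SpinT.volumeEigenspace k 1,
    SpinT.volumeEigenspace k (-1), rfl, rfl,
    SpinT.volumeEigenspace_isIrreducible (⟨0, hk⟩ : Fin k) (a := fun _ => 0) ?_,
    SpinT.volumeEigenspace_isIrreducible (⟨0, hk⟩ : Fin k)
      (a := Pi.single ⟨0, hk⟩ 1) ?_⟩
  · simp [SpinT.parity, SpinT.sgn]
  · rw [SpinT.parity, Finset.prod_eq_single ⟨0, hk⟩]
    · simp [SpinT.sgn]
    · intro j _ hj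
      simp [SpinT.sgn, hj]
    · simp
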